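/- Let $n\ge 1$ be an integer and $\delta>0$. For $\beta<n+2$ and $\nu\in\mathbb{R}^n$ let $$m^{\delta,\beta}(\nu)=c^{\delta,\beta}\int_{B_\delta(0)}\frac{\cos(\nu\cdot z)-1}{\|z\|^\beta}\,dz,\qquad c^{\delta,\beta}=\Big(\frac1{2n}\int_{B_\delta(0)}\frac{\|z\|^2}{\|z\|^\beta}\,dz\Big)^{-1},$$ where $B_\delta(0)\subset\mathbb{R}^n$ is the ball of radius $\delta$ centred at $0$. These are the Fourier multipliers of the nonlocal Laplacian $u\mapsto c^{\delta,\beta}\int_{B_\delta(0)}\frac{u(\cdot+z)-u(\cdot)}{\|z\|^\beta}\,dz$. Then for every $\nu\in\mathbb{R}^n$ the limit $m^{\delta,-\infty}(\nu):=\lim_{\beta\to-\infty}m^{\delta,\beta}(\nu)$ exists in $\mathbb{R}$, and the following hold. (i) As $\nu\to 0$, $\nu\neq 0$, $$\frac{m^{\delta,-\infty}(\nu)}{-\|\nu\|^2}=1-\frac{\delta^2}{4(n+2)}\|\nu\|^2+O(\|\nu\|^4).$$ (ii) As $\|\nu\|\to\infty$, $$m^{\delta,-\infty}(\nu)=\Big(\frac2\delta\Big)^{\frac{n+3}2}\frac{\Gamma(\frac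 n2+1)}{\pi^{1/2}}\cos\Big(\|\nu\|\delta-\frac{n-1}4\pi\Big)\|\nu\|^{-\frac{n-1}2}-\frac{2n}{\delta^2}+O\big(\|\nu\|^{-\frac{n+1}2}\big),$$ and for $n=1$ and $n=3$ the error term is moreover $O\big(\|\nu\|^{-\frac{n+2}2}\big)$. The implied constants may depend on $n$ and $\delta$. -/

import Mathlib

open Real Filter Topology MeasureTheory Asymptotics

namespace Peridynamic

noncomputable section

/-- The scaling constant `c^{δ,β}`, normalised so that the nonlocal Laplacian maps `‖z‖²` to `2n`:
the inverse of `(1 / 2n) ∫_{B_δ(0)} ‖z‖² / ‖z‖^β dz`. -/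
def scalingConstant (n : ℕ) (δ β : ℝ) : ℝ :=
  (1 / (2 * (n : ℝ)) *
    ∫ z in Metric.ball (0 : EuclideanSpace ℝ (Fin n)) δ, ‖z‖ ^ 2 / ‖z‖ ^ β)⁻¹

/-- The Fourier multiplier `m^{δ,β}(ν) = c^{δ,β} ∫_{B_δ(0)} (cos(ν · z) - 1) / ‖z‖^β dz` of the
nonlocal Laplacian (for `β < n + 2`, where the integrals converge). -/
def multiplier (n : ℕ) (δ β : ℝ) (ν : EuclideanSpace ℝ (Fin n)) : ℝ :=
  scalingConstant n δ β *
    ∫ z in Metric.ball (0 : EuclideanSpace ℝ (Fin n)) δ, (cos (inner ℝ ν z) - 1) / ‖z‖ ^ β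

/-- The limiting multiplier `m^{δ,-∞}(ν) = lim_{β → -∞} m^{δ,β}(ν)`. -/
def limitMultiplier (n : ℕ) (δ : ℝ) (ν : EuclideanSpace ℝ (Fin n)) : ℝ :=
  limUnder atBot (fun β : ℝ => multiplier n δ β ν)

/-- The principal part of the limiting multiplier at high frequency:
`(2/δ)^((n+3)/2) Γ(n/2+1) π^(-1/2) cos(‖ν‖δ - (n-1)π/4) ‖ν‖^(-(n-1)/2) - 2n/δ²`. -/
def highFrequencyPart (n : ℕ) (δ : ℝ) (ν : EuclideanSpace ℝ (Fin n)) : ℝ :=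
  (2 / δ) ^ (((n : ℝ) + 3) / 2) * (Gamma ((n : ℝ) / 2 + 1) / π ^ (1 / 2 : ℝ)) *
      cos (‖ν‖ * δ - ((n : ℝ) - 1) / 4 * π) * ‖ν‖ ^ (-(((n : ℝ) - 1) / 2))
    - 2 * (n : ℝ) / δ ^ 2

end

end Peridynamic

/-! With `β = -p` and `p → ∞`, the normalised weight `‖z‖ ^ p` concentrates on the sphere of radius
`δ`. Hence the limit is `2n/δ² (Λ(δ‖ν‖) - 1)`, where `Λ(s)` is the mean of `cos (s⟨u, θ⟩)` over the
unit sphere (`tendsto_multiplier`). Both expansions are therefore statements about `Λ = sphericalCos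
n`. It is defined by its power series, so that identities for it reduce to the recurrence
`sphereMoment_succ`.

Near `0`, averaging the Taylor polynomial of the cosine and inserting the second and fourth moments
gives (i) (`abs_sphericalCos_sub_le`).

At infinity the dimension matters. For `n > 3`, `Λ` is a normalised Poisson integral of `cos (st) (1
- t²)^α` with `α = (n-3)/2 > 0`. Moving the contour to the vertical rays above `±1`
(`integral_cos_eq_im_integral_ray`) leaves a Laplace integral, whose first term is explicit
(`exists_norm_integral_ray_sub_le`). For `n = 1` and `n = 3`, `Λ` is `cos s` and `sin s / s`, which
equal the leading term, so the error vanishes. For `n = 2` the Poisson weight is singular;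
`sphericalCos_two` reduces this case to dimensions 4 and 6. -/

namespace Peridynamic

noncomputable section

/-! ### Even moments of the unit sphere, from Gaussian integrals. -/

/-- Polar coordinates for a product of a function of the direction and a function of the norm. -/
lemma integral_direction_mul_norm {E : Type*} [NormedAddCommGroup E] [NormedSpace ℝ E]
    [MeasurableSpace E] [BorelSpace E] [Nontrivial E] [FiniteDimensional ℝ E] (μ : Measure E)
    [μ.IsAddHaarMeasure] (h : E → ℝ) (w : ℝ → ℝ) :
    ∫ x, h (‖x‖⁻¹ • x) * w ‖x‖ ∂μ =
      (∫ θ, h (θ : E) ∂μ.toSphere) *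
        ∫ r in Set.Ioi (0 : ℝ), r ^ (Module.finrank ℝ E - 1) * w r :=
  calc
    ∫ x, h (‖x‖⁻¹ • x) * w ‖x‖ ∂μ
      = ∫ x : ({(0)}ᶜ : Set E), h (‖x.1‖⁻¹ • x.1) * w ‖x.1‖ ∂(μ.comap (↑)) := by
      rw [integral_subtype_comap (measurableSet_singleton _).compl
        fun x ↦ h (‖x‖⁻¹ • x) * w ‖x‖, restrict_compl_singleton]
    _ = ∫ x, h x.1 * w x.2 ∂μ.toSphere.prod (.volumeIoiPow (Module.finrank ℝ E - 1)) := by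
      simpa using μ.measurePreserving_homeomorphUnitSphereProd.integral_comp
        (Homeomorph.measurableEmbedding _)
        (fun p : Metric.sphere (0 : E) 1 × Set.Ioi (0 : ℝ) => h p.1 * w p.2)
    _ = (∫ θ, h (θ : E) ∂μ.toSphere) *
        ∫ x : Set.Ioi (0 : ℝ), w x ∂.volumeIoiPow (Module.finrank ℝ E - 1) :=
      integral_prod_mul (fun θ : Metric.sphere (0 : E) 1 => h θ) (fun r : Set.Ioi (0 : ℝ) => w r)
    _ = _ := by
      congr 1
      simp only [Measure.volumeIoiPow, ENNReal.ofReal]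
      rw [integral_withDensity_eq_integral_smul,
        integral_subtype_comap measurableSet_Ioi
          fun a ↦ Real.toNNReal (a ^ (Module.finrank ℝ E - 1)) • w a,
        setIntegral_congr_fun measurableSet_Ioi fun x hx ↦ ?_]
      · rw [NNReal.smul_def, Real.coe_toNNReal _ (pow_nonneg hx.out.le _), smul_eq_mul]
      · exact (measurable_subtype_coe.pow_const _).real_toNNReal

lemma integral_Ioi_pow_mul_exp_neg_sq (m : ℕ) :
    ∫ r in Set.Ioi (0 : ℝ), r ^ m * exp (-r ^ 2) = Gamma (((m : ℝ) + 1) / 2) / 2 := by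
  have h := integral_rpow_mul_exp_neg_rpow (p := 2) (q := m) (by norm_num)
    (by linarith [(Nat.cast_nonneg m : (0 : ℝ) ≤ m)])
  rw [← show (1 / 2 : ℝ) * Gamma (((m : ℝ) + 1) / 2) = Gamma (((m : ℝ) + 1) / 2) / 2 by ring, ← h]
  refine setIntegral_congr_fun measurableSet_Ioi fun r _ => ?_
  simp only [rpow_natCast, rpow_ofNat]

lemma integral_pow_even_mul_exp_neg_sq (k : ℕ) :
    ∫ r : ℝ, r ^ (2 * k) * exp (-r ^ 2) = Gamma ((k : ℝ) + 1 / 2) := by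
  have h := integral_comp_abs (f := fun r : ℝ => r ^ (2 * k) * exp (-r ^ 2))
  simp only [Even.pow_abs (even_two_mul k), sq_abs] at h
  rw [h, integral_Ioi_pow_mul_exp_neg_sq]
  push_cast
  rw [show ((2 : ℝ) * k + 1) / 2 = k + 1 / 2 by ring]
  ring

variable {n : ℕ}

lemma integral_coordinate_pow_mul_exp_neg_norm_sq (i₀ : Fin n) (k : ℕ) :
    ∫ x : EuclideanSpace ℝ (Fin n), (x i₀) ^ (2 * k) * exp (-‖x‖ ^ 2) =
      Gamma ((k : ℝ) + 1 / 2) * √π ^ (n - 1) := by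
  have h1 := (EuclideanSpace.volume_preserving_symm_measurableEquiv_toLp (Fin n)).symm.integral_comp'
    (g := fun x : EuclideanSpace ℝ (Fin n) => (x i₀) ^ (2 * k) * exp (-‖x‖ ^ 2))
  rw [← h1]
  have h2 : ∀ x : Fin n → ℝ,
      ((MeasurableEquiv.toLp 2 (Fin n → ℝ)).symm.symm x i₀) ^ (2 * k) *
        exp (-‖(MeasurableEquiv.toLp 2 (Fin n → ℝ)).symm.symm x‖ ^ 2) =
      ∏ i, (if i = i₀ then fun r : ℝ => r ^ (2 * k) * exp (-r ^ 2)
        else fun r : ℝ => exp (-r ^ 2)) (x i) := by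
    intro x
    rw [EuclideanSpace.norm_sq_eq, ← Finset.mul_prod_erase _ _ (Finset.mem_univ i₀),
      Finset.prod_congr rfl (g := fun i => exp (-(x i) ^ 2)), if_pos rfl, mul_assoc,
      Finset.mul_prod_erase _ (fun i => exp (-(x i) ^ 2)) (Finset.mem_univ i₀),
      ← Finset.sum_neg_distrib, exp_sum]
    · simp
    · intro i hi
      rw [if_neg (Finset.ne_of_mem_erase hi)]
  simp_rw [h2]
  rw [integral_fintype_prod_volume_eq_prod, ← Finset.mul_prod_erase _ _ (Finset.mem_univ i₀),
    Finset.prod_congr rfl (g := fun _ => √π), if_pos rfl, integral_pow_even_mul_exp_neg_sq]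
  · simp
  · intro i hi
    rw [if_neg (Finset.ne_of_mem_erase hi)]
    simpa using integral_gaussian 1

/-- The Gaussian is rotation invariant: extend `u` to an orthonormal basis and pass to its
coordinates. -/
lemma integral_inner_pow_mul_exp_neg_norm_sq (u : EuclideanSpace ℝ (Fin n)) (hu : ‖u‖ = 1)
    (k : ℕ) :
    ∫ x : EuclideanSpace ℝ (Fin n), (inner ℝ u x) ^ (2 * k) * exp (-‖x‖ ^ 2) =
      Gamma ((k : ℝ) + 1 / 2) * √π ^ (n - 1) := by
  have i₀ : Fin n := by
    rcases n with _ | n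
    · simp [Subsingleton.elim u 0] at hu
    · exact 0
  obtain ⟨b, hb⟩ := Orthonormal.exists_orthonormalBasis_extension_of_card_eq (𝕜 := ℝ)
    (E := EuclideanSpace ℝ (Fin n)) (ι := Fin n) (by simp) (v := fun _ => u) (s := {i₀})
    (by
      rw [orthonormal_iff_ite]
      rintro ⟨i, rfl⟩ ⟨j, rfl⟩
      simp [hu])
  have hb0 : b i₀ = u := hb i₀ rfl
  have h := b.measurePreserving_repr.integral_comp b.repr.toHomeomorph.measurableEmbedding
    (fun x => (x i₀) ^ (2 * k) * exp (-‖x‖ ^ 2))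
  rw [integral_coordinate_pow_mul_exp_neg_norm_sq i₀ k] at h
  simpa [OrthonormalBasis.repr_apply_apply, hb0] using h

/-- The even moments `Γ(n/2) Γ(k+1/2) / (√π Γ(k+n/2))` of a coordinate of a uniformly distributed
point of the unit sphere of `ℝⁿ`. -/
def sphereMoment (n k : ℕ) : ℝ :=
  Gamma ((n : ℝ) / 2) * Gamma ((k : ℝ) + 1 / 2) / (√π * Gamma ((k : ℝ) + (n : ℝ) / 2))

/-- The surface measure of the unit sphere of `ℝⁿ`. -/
abbrev surfaceMeasure (n : ℕ) : Measure (Metric.sphere (0 : EuclideanSpace ℝ (Fin n)) 1) :=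
  (volume : Measure (EuclideanSpace ℝ (Fin n))).toSphere

lemma nontrivial_euclideanSpace (hn : 1 ≤ n) : Nontrivial (EuclideanSpace ℝ (Fin n)) := by
  have : Nonempty (Fin n) := ⟨⟨0, hn⟩⟩
  infer_instance

/-- One Gaussian integral computed twice: the right side is its Cartesian value, the left side its
value in polar coordinates. -/
lemma integral_sphere_inner_pow_mul_Gamma (hn : 1 ≤ n) (u : EuclideanSpace ℝ (Fin n))
    (hu : ‖u‖ = 1) (k : ℕ) :
    (∫ θ, (inner ℝ u (θ : EuclideanSpace ℝ (Fin n))) ^ (2 * k) ∂surfaceMeasure n) *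
      (Gamma ((k : ℝ) + (n : ℝ) / 2) / 2) = Gamma ((k : ℝ) + 1 / 2) * √π ^ (n - 1) := by
  have := nontrivial_euclideanSpace hn
  have h := integral_direction_mul_norm (volume : Measure (EuclideanSpace ℝ (Fin n)))
    (fun x => (inner ℝ u x) ^ (2 * k)) (fun r => r ^ (2 * k) * exp (-r ^ 2))
  rw [← integral_inner_pow_mul_exp_neg_norm_sq u hu k]
  convert h.symm using 1
  · congr 1
    have := integral_Ioi_pow_mul_exp_neg_sq (n - 1 + 2 * k)
    simp only [finrank_euclideanSpace, Fintype.card_fin, ← mul_assoc, ← pow_add]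
    rw [this]
    push_cast [hn]
    ring_nf
  · refine integral_congr_ae (.of_forall fun x => ?_)
    rcases eq_or_ne x 0 with rfl | hx
    · simp only [inner_zero_right, norm_zero, smul_zero]
      rcases k with _ | k <;> simp
    · have : ‖x‖ ≠ 0 := norm_ne_zero_iff.2 hx
      simp only [inner_smul_right]
      rw [← mul_assoc, ← mul_pow, mul_right_comm, inv_mul_cancel₀ this, one_mul]

lemma surfaceMeasure_real_univ_pos (hn : 1 ≤ n) : 0 < (surfaceMeasure n).real Set.univ := by
  have := nontrivial_euclideanSpace hn
  have : NeZero (surfaceMeasure n) := ⟨Measure.toSphere_ne_zero _⟩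
  exact measureReal_univ_pos

/-- Dividing the preceding identity by its case `k = 0`, which gives the total mass, cancels the
powers of `√π`. -/
lemma average_inner_pow (hn : 1 ≤ n) (u : EuclideanSpace ℝ (Fin n)) (hu : ‖u‖ = 1) (k : ℕ) :
    ⨍ θ, (inner ℝ u (θ : EuclideanSpace ℝ (Fin n))) ^ (2 * k) ∂surfaceMeasure n =
      sphereMoment n k := by
  have h0 := integral_sphere_inner_pow_mul_Gamma hn u hu 0
  have hk := integral_sphere_inner_pow_mul_Gamma hn u hu k
  have hpos := surfaceMeasure_real_univ_pos hn
  have hn0 : (0 : ℝ) < n := by exact_mod_cast hn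
  simp only [mul_zero, pow_zero, integral_const, smul_eq_mul, mul_one, Nat.cast_zero, zero_add,
    Gamma_one_half_eq] at h0
  have g1 := Gamma_pos_of_pos (s := (n : ℝ) / 2) (by positivity)
  have g2 := Gamma_pos_of_pos (s := (k : ℝ) + (n : ℝ) / 2) (by positivity)
  have hp : 0 < √π := by positivity
  have hp' : 0 < √π ^ (n - 1) := by positivity
  rw [average_eq, smul_eq_mul, sphereMoment, inv_mul_eq_div, div_eq_div_iff hpos.ne' (by positivity)]
  have e1 : ∀ I S a b c p q : ℝ, 0 < q → S * (a / 2) = p * q → I * (b / 2) = c * q →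
      I * (p * b) = a * c * S := by
    intro I S a b c p q hq h1 h2
    apply mul_right_cancel₀ hq.ne'
    linear_combination (-2 * c * q) * h1 + (2 * p * q) * h2
  exact e1 _ _ _ _ _ _ _ hp' h0 hk

lemma hasSum_of_eq {f g : ℕ → ℝ} {a b : ℝ} (h : HasSum f a) (hfg : ∀ k, g k = f k) (hab : b = a) :
    HasSum g b := by
  rwa [funext hfg, hab]

/-! ### The spherical mean of the cosine. -/

/-- The Taylor series of the average of `cos (s ⟨u, θ⟩)` over the unit sphere of `ℝⁿ`, which is
`Γ(n/2) (2/s)^(n/2-1) J_{n/2-1}(s)`. -/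
def sphericalCos (n : ℕ) (s : ℝ) : ℝ :=
  ∑' k : ℕ, (-1) ^ k * s ^ (2 * k) / (2 * k).factorial * sphereMoment n k

lemma continuous_inner_sphere (u : EuclideanSpace ℝ (Fin n)) :
    Continuous fun θ : Metric.sphere (0 : EuclideanSpace ℝ (Fin n)) 1 =>
      inner ℝ u (θ : EuclideanSpace ℝ (Fin n)) := by
  fun_prop

lemma integrable_sphere {f : Metric.sphere (0 : EuclideanSpace ℝ (Fin n)) 1 → ℝ}
    (hf : Continuous f) : Integrable f (surfaceMeasure n) :=
  hf.integrable_of_hasCompactSupport (.of_compactSpace f)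

lemma abs_inner_sphere_le {u : EuclideanSpace ℝ (Fin n)} (hu : ‖u‖ = 1)
    (θ : Metric.sphere (0 : EuclideanSpace ℝ (Fin n)) 1) :
    |inner ℝ u (θ : EuclideanSpace ℝ (Fin n))| ≤ 1 := by
  have := abs_real_inner_le_norm u (θ : EuclideanSpace ℝ (Fin n))
  rwa [hu, norm_eq_of_mem_sphere, one_mul] at this

/-- The cosine transform of a finite measure, through its even moments. -/
lemma hasSum_integral_cos {α : Type*} [MeasurableSpace α] {μ : Measure α} {X g : α → ℝ}
    (hX : AEStronglyMeasurable X μ) (hg : Integrable g μ) (hb : ∀ᵐ a ∂μ, |X a| ≤ 1) (s : ℝ) :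
    HasSum (fun k : ℕ => (-1) ^ k * s ^ (2 * k) / (2 * k).factorial * ∫ a, X a ^ (2 * k) * g a ∂μ)
      (∫ a, cos (s * X a) * g a ∂μ) := by
  have hs : Summable fun k : ℕ => |s| ^ (2 * k) / (2 * k).factorial :=
    (Real.summable_pow_div_factorial |s|).comp_injective (mul_right_injective₀ two_ne_zero)
  have h := hasSum_integral_of_dominated_convergence (μ := μ)
    (F := fun (k : ℕ) a => (-1) ^ k * s ^ (2 * k) / (2 * k).factorial * (X a ^ (2 * k) * g a))
    (f := fun a => cos (s * X a) * g a)
    (fun k a => |s| ^ (2 * k) / (2 * k).factorial * |g a|)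
    (fun k => ((hX.pow _).mul hg.aestronglyMeasurable).const_mul _)
    (fun k => by
      filter_upwards [hb] with a ha
      simp only [norm_mul, norm_div, norm_pow, norm_neg, norm_one, one_pow, one_mul, norm_eq_abs,
        Nat.abs_cast]
      gcongr
      exact mul_le_of_le_one_left (abs_nonneg _) (pow_le_one₀ (abs_nonneg _) ha))
    (.of_forall fun a => hs.mul_right _)
    (by
      simp_rw [tsum_mul_right]
      exact hg.abs.const_mul _)
    (.of_forall fun a => by
      refine hasSum_of_eq ((hasSum_cos (s * X a)).mul_right (g a)) (fun k => ?_) rfl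
      rw [mul_pow]
      ring)
  simpa only [integral_const_mul] using h

lemma hasSum_average_cos (hn : 1 ≤ n) {u : EuclideanSpace ℝ (Fin n)} (hu : ‖u‖ = 1) (s : ℝ) :
    HasSum (fun k : ℕ => (-1) ^ k * s ^ (2 * k) / (2 * k).factorial * sphereMoment n k)
      (⨍ θ, cos (s * inner ℝ u (θ : EuclideanSpace ℝ (Fin n))) ∂surfaceMeasure n) := by
  have h := (hasSum_integral_cos (μ := surfaceMeasure n) (g := fun _ => 1)
    (continuous_inner_sphere u).aestronglyMeasurable (integrable_const 1)
    (.of_forall (abs_inner_sphere_le hu)) s).mul_left ((surfaceMeasure n).real Set.univ)⁻¹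
  simp only [mul_one] at h
  refine hasSum_of_eq h (fun k => ?_) ?_
  · rw [← average_inner_pow hn u hu, average_eq, smul_eq_mul]
    ring
  · rw [average_eq, smul_eq_mul]

lemma exists_norm_eq_one (hn : 1 ≤ n) : ∃ u : EuclideanSpace ℝ (Fin n), ‖u‖ = 1 :=
  ⟨EuclideanSpace.single ⟨0, hn⟩ 1, by simp⟩

lemma hasSum_sphericalCos (hn : 1 ≤ n) (s : ℝ) :
    HasSum (fun k : ℕ => (-1) ^ k * s ^ (2 * k) / (2 * k).factorial * sphereMoment n k)
      (sphericalCos n s) := by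
  obtain ⟨u, hu⟩ := exists_norm_eq_one hn
  exact (hasSum_average_cos hn hu s).summable.hasSum

lemma average_cos_eq (hn : 1 ≤ n) {u : EuclideanSpace ℝ (Fin n)} (hu : ‖u‖ = 1) (s : ℝ) :
    ⨍ θ, cos (s * inner ℝ u (θ : EuclideanSpace ℝ (Fin n))) ∂surfaceMeasure n =
      sphericalCos n s :=
  (hasSum_average_cos hn hu s).unique (hasSum_sphericalCos hn s)

lemma sphereMoment_zero (hn : 1 ≤ n) : sphereMoment n 0 = 1 := by
  have hn0 : (0 : ℝ) < n := by exact_mod_cast hn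
  have g := Gamma_pos_of_pos (s := (n : ℝ) / 2) (by positivity)
  have hp : 0 < √π := by positivity
  rw [sphereMoment, Nat.cast_zero, zero_add, zero_add, Gamma_one_half_eq]
  field_simp

/-- With the value `1` at `k = 0` this recurrence determines the moments; the closed forms and the
Poisson integral below are identified through it. -/
lemma sphereMoment_succ (hn : 1 ≤ n) (k : ℕ) :
    sphereMoment n (k + 1) = (2 * k + 1) / (2 * k + n) * sphereMoment n k := by
  have hn0 : (0 : ℝ) < n := by exact_mod_cast hn
  have g := Gamma_pos_of_pos (s := (k : ℝ) + (n : ℝ) / 2) (by positivity)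
  have hp : 0 < √π := by positivity
  rw [sphereMoment, sphereMoment, Nat.cast_succ, show (k : ℝ) + 1 + 1 / 2 = k + 1 / 2 + 1 by ring,
    show (k : ℝ) + 1 + n / 2 = k + n / 2 + 1 by ring, Gamma_add_one (by positivity),
    Gamma_add_one (by positivity)]
  field_simp

/-- Real part of the Taylor bound for `exp (ix)`. Order six is needed because (i) divides by `‖ν‖²`
and keeps an error `‖ν‖⁴`. -/
lemma cos_taylor_six (x : ℝ) :
    |cos x - (1 - x ^ 2 / 2 + x ^ 4 / 24)| ≤ |x| ^ 6 * exp |x| := by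
  have h := Complex.norm_exp_sub_sum_le_norm_mul_exp (x * Complex.I) 6
  have h2 : ‖(x : ℂ) * Complex.I‖ = |x| := by simp
  rw [h2] at h
  refine le_trans (le_trans (le_of_eq ?_) (Complex.abs_re_le_norm _)) h
  congr 1
  rw [Complex.sub_re, Complex.exp_ofReal_mul_I_re]
  congr 1
  simp only [Finset.sum_range_succ, Finset.sum_range_zero, mul_pow, Nat.factorial]
  rw [show Complex.I ^ 3 = -Complex.I from Complex.I_pow_three, Complex.I_pow_four,
    show Complex.I ^ 5 = Complex.I by rw [pow_succ, Complex.I_pow_four, one_mul], Complex.I_sq]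
  norm_num [← Complex.ofReal_pow, Complex.div_re]
  ring

lemma abs_sphericalCos_sub_le (hn : 1 ≤ n) (s : ℝ) :
    |sphericalCos n s - (1 - s ^ 2 / (2 * n) + s ^ 4 / (8 * (n * (n + 2))))| ≤
      |s| ^ 6 * exp |s| := by
  obtain ⟨u, hu⟩ := exists_norm_eq_one hn
  have hpos := surfaceMeasure_real_univ_pos hn
  have hn0 : (0 : ℝ) < n := by exact_mod_cast hn
  have m1 := average_inner_pow hn u hu 1
  have m2 := average_inner_pow hn u hu 2
  rw [sphereMoment_succ hn, sphereMoment_zero hn] at m1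
  rw [sphereMoment_succ hn, sphereMoment_succ hn, sphereMoment_zero hn] at m2
  rw [← average_cos_eq hn hu]
  rw [average_eq, smul_eq_mul, inv_mul_eq_div, div_eq_iff hpos.ne'] at m1 m2
  rw [average_eq, smul_eq_mul, inv_mul_eq_div]
  set σ := (surfaceMeasure n).real Set.univ
  have hc := continuous_inner_sphere u
  have key : (∫ θ, cos (s * inner ℝ u (θ : EuclideanSpace ℝ (Fin n))) ∂surfaceMeasure n) -
      σ * (1 - s ^ 2 / (2 * n) + s ^ 4 / (8 * (n * (n + 2)))) =
      ∫ θ, (cos (s * inner ℝ u (θ : EuclideanSpace ℝ (Fin n))) -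
        (1 - (s * inner ℝ u (θ : EuclideanSpace ℝ (Fin n))) ^ 2 / 2 +
          (s * inner ℝ u (θ : EuclideanSpace ℝ (Fin n))) ^ 4 / 24)) ∂surfaceMeasure n := by
    rw [integral_sub (integrable_sphere (by fun_prop)) (integrable_sphere (by fun_prop)),
      integral_add (integrable_sphere (by fun_prop)) (integrable_sphere (by fun_prop)),
      integral_sub (integrable_sphere (by fun_prop)) (integrable_sphere (by fun_prop))]
    simp only [mul_pow, mul_div_assoc, integral_const_mul, integral_div, integral_const,
      smul_eq_mul, mul_one]
    norm_num at m1 m2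
    rw [m1, m2]
    field_simp
    ring
  have hle := norm_integral_le_of_norm_le_const (μ := surfaceMeasure n)
    (f := fun θ => cos (s * inner ℝ u (θ : EuclideanSpace ℝ (Fin n))) -
        (1 - (s * inner ℝ u (θ : EuclideanSpace ℝ (Fin n))) ^ 2 / 2 +
          (s * inner ℝ u (θ : EuclideanSpace ℝ (Fin n))) ^ 4 / 24))
    (C := |s| ^ 6 * exp |s|) (.of_forall fun θ => by
      refine (cos_taylor_six (s * inner ℝ u (θ : EuclideanSpace ℝ (Fin n)))).trans ?_
      have : |s * inner ℝ u (θ : EuclideanSpace ℝ (Fin n))| ≤ |s| := by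
        rw [abs_mul]
        exact mul_le_of_le_one_right (abs_nonneg _) (abs_inner_sphere_le hu θ)
      gcongr)
  rw [← key, norm_eq_abs] at hle
  rw [div_sub' hpos.ne', abs_div, abs_of_pos hpos, div_le_iff₀ hpos]
  exact hle

lemma sphericalCos_one (s : ℝ) : sphericalCos 1 s = cos s := by
  have hm : ∀ k, sphereMoment 1 k = 1 := by
    intro k
    induction k with
    | zero => exact sphereMoment_zero le_rfl
    | succ k ih =>
      rw [sphereMoment_succ le_rfl, ih, Nat.cast_one, mul_one, div_self (by positivity)]
  have h := hasSum_sphericalCos (n := 1) le_rfl s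
  simp only [hm, mul_one] at h
  exact h.unique (hasSum_cos s)

lemma mul_sphericalCos_three (s : ℝ) : s * sphericalCos 3 s = sin s := by
  have hm : ∀ k : ℕ, sphereMoment 3 k = 1 / (2 * k + 1) := by
    intro k
    induction k with
    | zero => simp [sphereMoment_zero]
    | succ k ih =>
      rw [sphereMoment_succ (by norm_num), ih]
      push_cast
      field_simp
      ring
  have h := (hasSum_sphericalCos (n := 3) (by norm_num) s).mul_left s
  refine h.unique ?_
  refine hasSum_of_eq (hasSum_sin s) (fun k => ?_) rfl
  rw [hm, Nat.factorial_succ, pow_succ]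
  push_cast
  field_simp

/-- This is the Bessel recurrence `J₀ = (2/s) J₁ - J₂`, checked coefficient by coefficient. -/
lemma sphericalCos_two (s : ℝ) :
    sphericalCos 2 s = sphericalCos 4 s - s ^ 2 / 8 * sphericalCos 6 s := by
  have h2 : ∀ k : ℕ, sphereMoment 2 k = (k + 1) * sphereMoment 4 k := by
    intro k
    induction k with
    | zero => simp [sphereMoment_zero]
    | succ k ih =>
      rw [sphereMoment_succ (by norm_num), sphereMoment_succ (by norm_num), ih]
      push_cast
      field_simp
      ring
  have h6 : ∀ k : ℕ, sphereMoment 6 k = 2 / (k + 2) * sphereMoment 4 k := by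
    intro k
    induction k with
    | zero => simp [sphereMoment_zero]
    | succ k ih =>
      rw [sphereMoment_succ (by norm_num), sphereMoment_succ (by norm_num), ih]
      push_cast
      field_simp
      ring
  have e2 := hasSum_sphericalCos (n := 2) (by norm_num) s
  have e4 := hasSum_sphericalCos (n := 4) (by norm_num) s
  have e6 := (hasSum_sphericalCos (n := 6) (by norm_num) s).mul_left (s ^ 2 / 8)
  have e := e2.sub e4
  -- The constant terms in dimensions 2 and 4 cancel; the shift by one then matches the factor `s²`.
  rw [← hasSum_nat_add_iff' 1] at e
  have := e.unique (a₂ := -(s ^ 2 / 8 * sphericalCos 6 s)) (by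
    refine hasSum_of_eq e6.neg (fun k => ?_) rfl
    rw [h2, h6, sphereMoment_succ (by norm_num), show 2 * (k + 1) = 2 * k + 1 + 1 by ring,
      Nat.factorial_succ, Nat.factorial_succ]
    push_cast
    field_simp
    ring)
  simp only [Finset.range_one, Finset.sum_singleton, h2 0] at this
  simp at this
  linarith

/-! ### Concentration on the boundary sphere as `β → -∞`. -/

lemma setIntegral_ball_direction_mul_rpow (hn : 1 ≤ n) (h : EuclideanSpace ℝ (Fin n) → ℝ)
    {δ p : ℝ} (hδ : 0 < δ) (hp : 0 < p) :
    ∫ z in Metric.ball (0 : EuclideanSpace ℝ (Fin n)) δ, h (‖z‖⁻¹ • z) * ‖z‖ ^ p =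
      (∫ θ, h (θ : EuclideanSpace ℝ (Fin n)) ∂surfaceMeasure n) * (δ ^ (n + p) / (n + p)) := by
  have := nontrivial_euclideanSpace hn
  have hn0 : (0 : ℝ) < n := by exact_mod_cast hn
  rw [← integral_indicator measurableSet_ball]
  have e := integral_direction_mul_norm (volume : Measure (EuclideanSpace ℝ (Fin n))) h
    (fun r => (Set.Iio δ).indicator (fun r => r ^ p) r)
  convert e using 1
  · refine integral_congr_ae (.of_forall fun z => ?_)
    by_cases hz : ‖z‖ < δ <;> simp [Set.indicator, hz]
  · congr 1
    simp only [finrank_euclideanSpace, Fintype.card_fin]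
    have e2 : ∀ r ∈ Set.Ioi (0 : ℝ), r ^ (n - 1) * (Set.Iio δ).indicator (fun r => r ^ p) r =
        (Set.Iio δ).indicator (fun r => r ^ ((n : ℝ) - 1 + p)) r := by
      intro r hr
      by_cases h : r < δ
      · simp only [Set.mem_Iio, h, Set.indicator_of_mem]
        rw [rpow_add hr, ← Nat.cast_pred hn, rpow_natCast]
      · simp [h]
    rw [setIntegral_congr_fun measurableSet_Ioi e2, setIntegral_indicator measurableSet_Iio,
      Set.Ioi_inter_Iio, ← integral_Ioc_eq_integral_Ioo, ← intervalIntegral.integral_of_le hδ.le,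
      integral_rpow (Or.inl (by linarith)), zero_rpow (by linarith)]
    ring_nf

lemma setIntegral_ball_norm_rpow (hn : 1 ≤ n) {δ p : ℝ} (hδ : 0 < δ) (hp : 0 < p) :
    ∫ z in Metric.ball (0 : EuclideanSpace ℝ (Fin n)) δ, ‖z‖ ^ p =
      (surfaceMeasure n).real Set.univ * (δ ^ (n + p) / (n + p)) := by
  have := setIntegral_ball_direction_mul_rpow hn (fun _ => 1) hδ hp
  simpa using this

lemma integrableOn_ball_norm_rpow (δ : ℝ) {p : ℝ} (hp : 0 < p) :
    IntegrableOn (fun z : EuclideanSpace ℝ (Fin n) => ‖z‖ ^ p) (Metric.ball 0 δ) :=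
  ((continuous_norm.rpow_const fun _ => Or.inr hp.le).continuousOn.integrableOn_compact
    (isCompact_closedBall 0 δ)).mono_set Metric.ball_subset_closedBall

/-- The cosine is 1-Lipschitz, and `z` lies at distance `δ - ‖z‖` from its radial projection onto
the sphere of radius `δ`. -/
lemma abs_cos_inner_sub_le (ν z : EuclideanSpace ℝ (Fin n)) {δ : ℝ} (hz : ‖z‖ ≤ δ) :
    |cos (inner ℝ ν z) - cos (δ * inner ℝ ν (‖z‖⁻¹ • z))| ≤ ‖ν‖ * (δ - ‖z‖) := by
  have hδ : 0 ≤ δ - ‖z‖ := by linarith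
  rcases eq_or_ne z 0 with rfl | h0
  · simp only [inner_zero_right, smul_zero, mul_zero, sub_self, abs_zero]
    positivity
  · have hpos : 0 < ‖z‖ := norm_pos_iff.2 h0
    refine (abs_cos_sub_cos_le _ _).trans ?_
    have e : inner ℝ ν z - δ * inner ℝ ν (‖z‖⁻¹ • z) = -(inner ℝ ν z / ‖z‖ * (δ - ‖z‖)) := by
      rw [inner_smul_right]
      field_simp
      ring
    rw [e, abs_neg, abs_mul, abs_of_nonneg hδ, abs_div, abs_of_pos hpos]
    gcongr
    rw [div_le_iff₀ hpos]
    exact abs_real_inner_le_norm ν z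

/-- Replacing `z` by its radial projection costs at most `‖ν‖ (δ - ‖z‖)`, which integrates exactly
against `‖z‖ ^ p`. -/
lemma abs_setIntegral_cos_sub_le (hn : 1 ≤ n) (ν : EuclideanSpace ℝ (Fin n)) {δ p : ℝ}
    (hδ : 0 < δ) (hp : 0 < p) :
    |(∫ z in Metric.ball (0 : EuclideanSpace ℝ (Fin n)) δ, (cos (inner ℝ ν z) - 1) * ‖z‖ ^ p) -
        (∫ θ, (cos (δ * inner ℝ ν (θ : EuclideanSpace ℝ (Fin n))) - 1) ∂surfaceMeasure n) *
          (δ ^ (n + p) / (n + p))| ≤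
      ‖ν‖ * ((surfaceMeasure n).real Set.univ *
        (δ * (δ ^ (n + p) / (n + p)) - δ ^ (n + (p + 1)) / (n + (p + 1)))) := by
  have i1 := integrableOn_ball_norm_rpow (n := n) δ hp
  have i2 := integrableOn_ball_norm_rpow (n := n) δ (p := p + 1) (by linarith)
  rw [← setIntegral_ball_direction_mul_rpow hn
    (fun x => cos (δ * inner ℝ ν x) - 1) hδ hp, mul_sub, mul_left_comm _ δ,
    ← setIntegral_ball_norm_rpow hn hδ hp, ← setIntegral_ball_norm_rpow hn hδ (by linarith),
    ← integral_const_mul, ← integral_sub (i1.const_mul δ) i2, ← integral_const_mul, ← integral_sub]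
  · refine norm_integral_le_of_norm_le (f := fun z => (cos (inner ℝ ν z) - 1) * ‖z‖ ^ p -
      (cos (δ * inner ℝ ν (‖z‖⁻¹ • z)) - 1) * ‖z‖ ^ p)
      (((i1.const_mul δ).sub i2).const_mul _) ?_
    filter_upwards [ae_restrict_mem measurableSet_ball] with z hz
    have hz' : ‖z‖ ≤ δ := (mem_ball_zero_iff.1 hz).le
    have h0 : 0 ≤ ‖z‖ ^ p := by positivity
    rw [← sub_mul, sub_sub_sub_cancel_right, norm_mul, norm_eq_abs, norm_eq_abs, abs_of_nonneg h0,
      rpow_add_one' (norm_nonneg z) (by linarith), mul_comm (‖z‖ ^ p) ‖z‖, ← sub_mul, ← mul_assoc]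
    gcongr
    exact abs_cos_inner_sub_le ν z hz'
  · refine Integrable.bdd_mul (c := 2) i1 ?_ (.of_forall fun z => ?_)
    · exact (by fun_prop : Continuous fun z : EuclideanSpace ℝ (Fin n) =>
        cos (inner ℝ ν z) - 1).aestronglyMeasurable
    · rw [norm_eq_abs, abs_le]
      constructor <;> linarith [neg_one_le_cos (inner ℝ ν z), cos_le_one (inner ℝ ν z)]
  · refine Integrable.bdd_mul (c := 2) i1 ?_ (.of_forall fun z => ?_)
    · exact (by fun_prop : Measurable fun z : EuclideanSpace ℝ (Fin n) =>
        cos (δ * inner ℝ ν (‖z‖⁻¹ • z)) - 1).aestronglyMeasurable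
    · rw [norm_eq_abs, abs_le]
      constructor <;> linarith [neg_one_le_cos (δ * inner ℝ ν (‖z‖⁻¹ • z)),
        cos_le_one (δ * inner ℝ ν (‖z‖⁻¹ • z))]

lemma integral_sphere_cos_sub_one (hn : 1 ≤ n) (ν : EuclideanSpace ℝ (Fin n)) (δ : ℝ) :
    ∫ θ, (cos (δ * inner ℝ ν (θ : EuclideanSpace ℝ (Fin n))) - 1) ∂surfaceMeasure n =
      (surfaceMeasure n).real Set.univ * (sphericalCos n (δ * ‖ν‖) - 1) := by
  obtain ⟨u, hu, hν⟩ : ∃ u : EuclideanSpace ℝ (Fin n), ‖u‖ = 1 ∧ ν = ‖ν‖ • u := by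
    rcases eq_or_ne ν 0 with rfl | h
    · obtain ⟨u, hu⟩ := exists_norm_eq_one hn
      exact ⟨u, hu, by simp⟩
    · have := norm_ne_zero_iff.2 h
      exact ⟨‖ν‖⁻¹ • ν, by simp [norm_smul, this], by simp [smul_smul, this]⟩
  have hpos := surfaceMeasure_real_univ_pos hn
  have hc := continuous_inner_sphere ν
  rw [← average_cos_eq hn hu, average_eq, smul_eq_mul, mul_sub, mul_inv_cancel_left₀ hpos.ne',
    mul_one, integral_sub (integrable_sphere (by fun_prop)) (integrable_const 1), integral_const,
    smul_eq_mul, mul_one]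
  congr 2 with θ
  nth_rewrite 1 [hν]
  rw [real_inner_smul_left, mul_assoc]

lemma multiplier_sub_le (hn : 1 ≤ n) (ν : EuclideanSpace ℝ (Fin n)) {δ p : ℝ}
    (hδ : 0 < δ) (hp : 0 < p) :
    |multiplier n δ (-p) ν -
        2 * n / δ ^ 2 * (sphericalCos n (δ * ‖ν‖) - 1) * ((n + p + 2) / (n + p))| ≤
      2 * n * ‖ν‖ / δ * ((n + p + 2) / (n + p) - (n + p + 2) / (n + p + 1)) := by
  have hn0 : (0 : ℝ) < n := by exact_mod_cast hn
  have hpos := surfaceMeasure_real_univ_pos hn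
  have h := abs_setIntegral_cos_sub_le hn ν hδ hp
  rw [integral_sphere_cos_sub_one hn] at h
  set σ := (surfaceMeasure n).real Set.univ
  set I := ∫ z in Metric.ball (0 : EuclideanSpace ℝ (Fin n)) δ, (cos (inner ℝ ν z) - 1) * ‖z‖ ^ p
  set A := sphericalCos n (δ * ‖ν‖) - 1
  have hP : 0 < δ ^ ((n : ℝ) + p) := rpow_pos_of_pos hδ _
  have hm : multiplier n δ (-p) ν =
      2 * n * (n + p + 2) / (σ * δ ^ ((n : ℝ) + p) * δ ^ 2) * I := by
    have e1 : ∫ z in Metric.ball (0 : EuclideanSpace ℝ (Fin n)) δ, ‖z‖ ^ 2 / ‖z‖ ^ (-p) =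
        σ * (δ ^ (n + (p + 2)) / (n + (p + 2))) := by
      rw [← setIntegral_ball_norm_rpow hn hδ (by linarith)]
      refine integral_congr_ae (.of_forall fun z => ?_)
      simp only
      rw [rpow_neg (norm_nonneg z), div_inv_eq_mul, rpow_add' (norm_nonneg z) (by linarith),
        rpow_two, mul_comm]
    rw [multiplier, scalingConstant, e1, ← add_assoc, rpow_add hδ, rpow_two]
    simp only [rpow_neg (norm_nonneg _), div_inv_eq_mul]
    rw [mul_comm, mul_comm _ I]
    congr 1
    field_simp
  rw [rpow_add hδ (n : ℝ) (p + 1), rpow_add hδ p, rpow_one, ← mul_assoc (δ ^ (n : ℝ)),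
    ← rpow_add hδ] at h
  have hc : 0 < 2 * n * (n + p + 2) / (σ * δ ^ ((n : ℝ) + p) * δ ^ 2) := by positivity
  have h' := mul_le_mul_of_nonneg_left h hc.le
  rw [← abs_of_pos hc, ← abs_mul, abs_of_pos hc] at h'
  rw [hm]
  refine (le_of_eq ?_).trans (h'.trans (le_of_eq ?_))
  · congr 1
    field_simp
  · rw [← add_assoc]
    field_simp

lemma tendsto_multiplier (hn : 1 ≤ n) (ν : EuclideanSpace ℝ (Fin n)) {δ : ℝ} (hδ : 0 < δ) :
    Tendsto (fun β : ℝ => multiplier n δ β ν) atBot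
      (𝓝 (2 * n / δ ^ 2 * (sphericalCos n (δ * ‖ν‖) - 1))) := by
  -- The case `c = 0` is the factor of the main term; the error bound is a multiple of the
  -- difference of the cases `c = 0` and `c = 1`.
  have hr : ∀ c : ℝ, Tendsto (fun p : ℝ => ((n : ℝ) + p + 2) / (n + p + c)) atTop (𝓝 1) := by
    intro c
    have h1 : Tendsto (fun p : ℝ => (n : ℝ) + p + c) atTop atTop :=
      tendsto_atTop_add_const_right _ _ (tendsto_atTop_add_const_left _ _ tendsto_id)
    have h2 : Tendsto (fun p : ℝ => 1 + (2 - c) * ((n : ℝ) + p + c)⁻¹) atTop (𝓝 1) := by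
      simpa using (h1.inv_tendsto_atTop.const_mul (2 - c)).const_add 1
    refine h2.congr' ?_
    filter_upwards [h1.eventually_gt_atTop 0] with p hp
    field_simp
    ring
  have h0 := hr 0
  simp only [add_zero] at h0
  have hlim := (h0.const_mul (2 * n / δ ^ 2 * (sphericalCos n (δ * ‖ν‖) - 1)))
  have herr := (h0.sub (hr 1)).const_mul (2 * n * ‖ν‖ / δ)
  rw [sub_self, mul_zero] at herr
  have h3 : Tendsto (fun p : ℝ => multiplier n δ (-p) ν -
        2 * n / δ ^ 2 * (sphericalCos n (δ * ‖ν‖) - 1) * ((n + p + 2) / (n + p))) atTop (𝓝 0) := by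
    refine squeeze_zero_norm' ?_ herr
    filter_upwards [eventually_gt_atTop 0] with p hp
    exact multiplier_sub_le hn ν hδ hp
  have h4 := (h3.add hlim).comp tendsto_neg_atBot_atTop
  simpa [Function.comp_def] using h4

lemma limitMultiplier_eq (hn : 1 ≤ n) (ν : EuclideanSpace ℝ (Fin n)) {δ : ℝ} (hδ : 0 < δ) :
    limitMultiplier n δ ν = 2 * n / δ ^ 2 * (sphericalCos n (δ * ‖ν‖) - 1) :=
  (tendsto_multiplier hn ν hδ).limUnder_eq

/-! ### Low frequencies. -/

/-- The expansion of the limiting multiplier at low frequency. -/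
lemma limitMultiplier_isBigO_zero (hn : 1 ≤ n) {δ : ℝ} (hδ : 0 < δ) :
    (fun ν : EuclideanSpace ℝ (Fin n) =>
        limitMultiplier n δ ν / (-‖ν‖ ^ 2) - (1 - δ ^ 2 / (4 * ((n : ℝ) + 2)) * ‖ν‖ ^ 2))
      =O[𝓝[≠] 0] (fun ν => ‖ν‖ ^ 4) := by
  have hn0 : (0 : ℝ) < n := by exact_mod_cast hn
  -- The constant is `2n/δ² · δ⁶ · exp δ`; the exponential is bounded using `‖ν‖ < 1`.
  refine IsBigO.of_bound (2 * n * δ ^ 4 * exp δ) ?_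
  have hb : ∀ᶠ ν : EuclideanSpace ℝ (Fin n) in 𝓝[≠] 0, ‖ν‖ < 1 :=
    eventually_nhdsWithin_of_eventually_nhds
      ((continuous_norm.tendsto' _ _ norm_zero).eventually_lt_const one_pos)
  filter_upwards [hb, self_mem_nhdsWithin] with ν h1 h0
  have hpos : 0 < ‖ν‖ := norm_pos_iff.2 h0
  have h := abs_sphericalCos_sub_le hn (δ * ‖ν‖)
  rw [limitMultiplier_eq hn ν hδ]
  have hc : 0 < 2 * n / δ ^ 2 / ‖ν‖ ^ 2 := by positivity
  have e : 2 * n / δ ^ 2 * (sphericalCos n (δ * ‖ν‖) - 1) / (-‖ν‖ ^ 2) -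
      (1 - δ ^ 2 / (4 * ((n : ℝ) + 2)) * ‖ν‖ ^ 2) =
      -((2 * n / δ ^ 2 / ‖ν‖ ^ 2) * (sphericalCos n (δ * ‖ν‖) -
        (1 - (δ * ‖ν‖) ^ 2 / (2 * n) + (δ * ‖ν‖) ^ 4 / (8 * (n * (n + 2)))))) := by
    field_simp
    ring
  have hs : 0 < δ * ‖ν‖ := by positivity
  rw [e, norm_neg, norm_mul, norm_of_nonneg hc.le, norm_eq_abs]
  rw [abs_of_pos hs] at h
  calc _ ≤ 2 * n / δ ^ 2 / ‖ν‖ ^ 2 * ((δ * ‖ν‖) ^ 6 * exp δ) := by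
        gcongr
        refine h.trans ?_
        gcongr
        nlinarith
    _ = 2 * n * δ ^ 4 * exp δ * ‖‖ν‖ ^ 4‖ := by
        rw [norm_of_nonneg (by positivity)]
        field_simp

/-! ### Poisson's integral for `n > 3`. -/

lemma continuous_one_sub_sq_rpow {α : ℝ} (hα : 0 ≤ α) :
    Continuous fun t : ℝ => (1 - t ^ 2) ^ α :=
  (by fun_prop : Continuous fun t : ℝ => 1 - t ^ 2).rpow_const fun _ => Or.inr hα

/-- Substituting `t = 2x - 1` turns `1 - t²` into `4x(1 - x)`, giving a Beta integral; Legendre's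
duplication formula simplifies it. -/
lemma integral_one_sub_sq_rpow {α : ℝ} (hα : 0 < α) :
    ∫ t in (-1 : ℝ)..1, (1 - t ^ 2) ^ α = √π * Gamma (α + 1) / Gamma (α + 3 / 2) := by
  have g1 := Gamma_pos_of_pos (s := α + 1) (by linarith)
  have g2 := Gamma_pos_of_pos (s := α + 3 / 2) (by linarith)
  have g3 := Gamma_pos_of_pos (s := 2 * α + 2) (by linarith)
  have hb := ProbabilityTheory.beta_eq_betaIntegralReal (α + 1) (α + 1) (by linarith)
    (by linarith)
  have hb2 : Complex.betaIntegral (α + 1 : ℝ) (α + 1 : ℝ) =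
      ((∫ x in (0 : ℝ)..1, (x * (1 - x)) ^ α : ℝ) : ℂ) := by
    rw [Complex.betaIntegral, ← intervalIntegral.integral_ofReal]
    refine intervalIntegral.integral_congr fun x hx => ?_
    rw [Set.uIcc_of_le zero_le_one] at hx
    have h1 : 0 ≤ 1 - x := by linarith [hx.2]
    rw [mul_rpow hx.1 h1, Complex.ofReal_mul, Complex.ofReal_cpow hx.1, Complex.ofReal_cpow h1]
    push_cast
    simp
  rw [hb2, Complex.ofReal_re, ProbabilityTheory.beta] at hb
  have hsub := intervalIntegral.integral_comp_mul_sub (a := 0) (b := 1)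
    (fun t : ℝ => (1 - t ^ 2) ^ α) (two_ne_zero (α := ℝ)) 1
  have he : ∫ x in (0 : ℝ)..1, (1 - (2 * x - 1) ^ 2) ^ α =
      4 ^ α * ∫ x in (0 : ℝ)..1, (x * (1 - x)) ^ α := by
    rw [← intervalIntegral.integral_const_mul]
    refine intervalIntegral.integral_congr fun x hx => ?_
    rw [Set.uIcc_of_le zero_le_one] at hx
    have h1 : 0 ≤ 1 - x := by linarith [hx.2]
    rw [← mul_rpow (by norm_num) (mul_nonneg hx.1 h1)]
    ring_nf
  rw [he, ← hb] at hsub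
  norm_num at hsub
  have hd := Gamma_mul_Gamma_add_half (α + 1)
  rw [show α + 1 + 1 / 2 = α + 3 / 2 by ring, show 2 * (α + 1) = 2 * α + 2 by ring] at hd
  rw [show α + 1 + (α + 1) = 2 * α + 2 by ring] at hsub
  have h4 : (2 : ℝ) ^ (1 - (2 * α + 2)) * (2 * (4 : ℝ) ^ α) = 1 := by
    have e4 : (4 : ℝ) ^ α = 2 ^ (2 * α) := by
      rw [rpow_mul (by norm_num)]
      norm_num
    have e2 : 2 * (2 : ℝ) ^ (2 * α) = 2 ^ (2 * α + 1) := by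
      rw [rpow_add_one (by norm_num), mul_comm]
    rw [e4, e2, ← rpow_add (by norm_num), show 1 - (2 * α + 2) + (2 * α + 1) = 0 by ring,
      rpow_zero]
  set J := ∫ t in (-1 : ℝ)..1, (1 - t ^ 2) ^ α
  have hJ : J = 2 * (4 ^ α * (Gamma (α + 1) * Gamma (α + 1) / Gamma (2 * α + 2))) := by
    linarith
  rw [hJ, eq_div_iff g2.ne', ← mul_div_assoc, ← mul_div_assoc, div_mul_eq_mul_div,
    div_eq_iff g3.ne']
  linear_combination (2 * 4 ^ α * Gamma (α + 1)) * hd +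
    (Gamma (α + 1) * Gamma (2 * α + 2) * √π) * h4

/-- Integrate the derivative of `t^(2k+1) (1 - t²)^(α+1)`, which vanishes at `±1`. For `2α + 3 = n`
the ratio is that of `sphereMoment_succ`. -/
lemma integral_pow_mul_one_sub_sq_rpow_succ {α : ℝ} (hα : 0 < α) (k : ℕ) :
    ∫ t in (-1 : ℝ)..1, t ^ (2 * (k + 1)) * (1 - t ^ 2) ^ α =
      (2 * k + 1) / (2 * k + (2 * α + 3)) *
        ∫ t in (-1 : ℝ)..1, t ^ (2 * k) * (1 - t ^ 2) ^ α := by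
  have hc := continuous_one_sub_sq_rpow hα.le
  have hd : ∀ t ∈ Set.uIcc (-1 : ℝ) 1,
      HasDerivAt (fun t : ℝ => t ^ (2 * k + 1) * (1 - t ^ 2) ^ (α + 1))
        ((2 * k + 1) * (t ^ (2 * k) * (1 - t ^ 2) ^ α) -
          (2 * k + (2 * α + 3)) * (t ^ (2 * (k + 1)) * (1 - t ^ 2) ^ α)) t := by
    intro t ht
    rw [Set.uIcc_of_le (by norm_num)] at ht
    have h0 : 0 ≤ 1 - t ^ 2 := by nlinarith [ht.1, ht.2]
    have h1 := ((hasDerivAt_pow 2 t).const_sub 1).rpow_const (p := α + 1)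
      (Or.inr (by linarith))
    refine ((hasDerivAt_pow (2 * k + 1) t).mul h1).congr_deriv ?_
    rw [add_sub_cancel_right, rpow_add_one' h0 (by linarith), Nat.add_sub_cancel]
    push_cast
    ring
  have h := intervalIntegral.integral_eq_sub_of_hasDerivAt hd
    ((by fun_prop : Continuous _).intervalIntegrable _ _)
  rw [intervalIntegral.integral_sub ((by fun_prop : Continuous _).intervalIntegrable _ _)
    ((by fun_prop : Continuous _).intervalIntegrable _ _), intervalIntegral.integral_const_mul,
    intervalIntegral.integral_const_mul] at h
  norm_num [zero_rpow (by linarith : α + 1 ≠ 0)] at h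
  have hp : (0 : ℝ) < 2 * k + (2 * α + 3) := by positivity
  rw [div_mul_eq_mul_div, eq_div_iff hp.ne']
  linarith

lemma integral_pow_mul_one_sub_sq_rpow {n : ℕ} (hn : 3 < n) (k : ℕ) :
    ∫ t in (-1 : ℝ)..1, t ^ (2 * k) * (1 - t ^ 2) ^ (((n : ℝ) - 3) / 2) =
      (∫ t in (-1 : ℝ)..1, (1 - t ^ 2) ^ (((n : ℝ) - 3) / 2)) * sphereMoment n k := by
  have hα : 0 < ((n : ℝ) - 3) / 2 := by
    have : (3 : ℝ) < n := by exact_mod_cast hn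
    linarith
  induction k with
  | zero => simp [sphereMoment_zero (by omega : 1 ≤ n)]
  | succ k ih =>
    rw [integral_pow_mul_one_sub_sq_rpow_succ hα, ih, sphereMoment_succ (by omega)]
    ring_nf

/-- Poisson's integral. -/
lemma integral_cos_mul_one_sub_sq_rpow {n : ℕ} (hn : 3 < n) (s : ℝ) :
    ∫ t in (-1 : ℝ)..1, cos (s * t) * (1 - t ^ 2) ^ (((n : ℝ) - 3) / 2) =
      (∫ t in (-1 : ℝ)..1, (1 - t ^ 2) ^ (((n : ℝ) - 3) / 2)) * sphericalCos n s := by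
  have hα : 0 < ((n : ℝ) - 3) / 2 := by
    have : (3 : ℝ) < n := by exact_mod_cast hn
    linarith
  have h := hasSum_integral_cos (μ := volume.restrict (Set.Ioc (-1 : ℝ) 1)) (X := id)
    (g := fun t => (1 - t ^ 2) ^ (((n : ℝ) - 3) / 2)) (by fun_prop)
    ((continuous_one_sub_sq_rpow hα.le).intervalIntegrable (-1) 1).1
    (by
      filter_upwards [ae_restrict_mem measurableSet_Ioc] with t ht
      exact abs_le.2 ⟨ht.1.le, ht.2⟩) s
  simp only [id, ← intervalIntegral.integral_of_le (by norm_num : (-1 : ℝ) ≤ 1)] at h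
  refine h.unique (hasSum_of_eq ((hasSum_sphericalCos (by omega : 1 ≤ n) s).mul_left
    (∫ t in (-1 : ℝ)..1, (1 - t ^ 2) ^ (((n : ℝ) - 3) / 2))) (fun k => ?_) rfl)
  rw [integral_pow_mul_one_sub_sq_rpow hn]
  ring

/-! ### The Laplace integral along the ray. -/

lemma ofReal_mul_cpow {y : ℝ} (hy : 0 ≤ y) {w : ℂ} (hw : w ≠ 0) {α : ℝ} (hα : α ≠ 0) :
    ((y : ℂ) * w) ^ (α : ℂ) = ((y ^ α : ℝ) : ℂ) * w ^ (α : ℂ) := by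
  have hα' : (α : ℂ) ≠ 0 := by exact_mod_cast hα
  rcases hy.eq_or_lt with rfl | hy'
  · simp [zero_rpow hα, hα']
  · have hy0 : (y : ℂ) ≠ 0 := by exact_mod_cast hy'.ne'
    rw [Complex.ofReal_cpow hy, Complex.cpow_def_of_ne_zero (mul_ne_zero hy0 hw),
      Complex.cpow_def_of_ne_zero hy0, Complex.cpow_def_of_ne_zero hw,
      Complex.log_ofReal_mul hy' hw, Complex.ofReal_log hy, add_mul, Complex.exp_add]

lemma sub_two_I_ne_zero (y : ℝ) : (y : ℂ) - 2 * Complex.I ≠ 0 := fun h => by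
  simpa using congrArg Complex.im h

lemma neg_two_I_cpow (α : ℝ) :
    (-(2 * Complex.I)) ^ (α : ℂ) =
      ((2 ^ α : ℝ) : ℂ) * Complex.exp (-(π * α / 2 : ℝ) * Complex.I) := by
  have h0 : (-(2 * Complex.I)) ≠ 0 := by simp
  have hl : Complex.log (-(2 * Complex.I)) = (log 2 : ℝ) + -(π / 2) * Complex.I := by
    have := Complex.log_ofReal_mul (r := 2) two_pos (x := -Complex.I) (by simp)
    rw [Complex.log_neg_I] at this
    rw [← neg_mul, ← this]
    push_cast
    ring_nf
  rw [Complex.cpow_def_of_ne_zero h0, hl, rpow_def_of_pos two_pos, Complex.ofReal_exp,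
    ← Complex.exp_add]
  push_cast
  ring_nf

/-- Mean value inequality on `[0, y]`: the derivative grows polynomially, which `exp (y / 2)`
absorbs. The rate `1/2` leaves decay against `exp (-(s * y))` for `s ≥ 1`. -/
lemma exists_norm_cpow_sub_le {α : ℝ} (hα : 0 < α) :
    ∃ C, 0 ≤ C ∧ ∀ y : ℝ, 0 ≤ y →
      ‖((y : ℂ) - 2 * Complex.I) ^ (α : ℂ) - (-(2 * Complex.I)) ^ (α : ℂ)‖ ≤
        C * (y * exp (y / 2)) := by
  obtain ⟨m, hm⟩ := exists_nat_ge α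
  refine ⟨α * (2 ^ m * m.factorial * exp 1), by positivity, fun y hy => ?_⟩
  have hd : ∀ x ∈ Set.Icc (0 : ℝ) y,
      HasDerivWithinAt (fun x : ℝ => ((x : ℂ) - 2 * Complex.I) ^ (α : ℂ))
        (α * ((x : ℂ) - 2 * Complex.I) ^ ((α : ℂ) - 1)) (Set.Icc 0 y) x := by
    intro x _
    have h1 : HasDerivAt (fun z : ℂ => (z - 2 * Complex.I) ^ (α : ℂ))
        (α * ((x : ℂ) - 2 * Complex.I) ^ ((α : ℂ) - 1) * 1) (x : ℂ) :=
      ((hasDerivAt_id (x : ℂ)).sub_const _).cpow_const (Or.inr (by simp))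
    rw [mul_one] at h1
    exact h1.comp_ofReal.hasDerivWithinAt
  have hbound : ∀ x ∈ Set.Ico (0 : ℝ) y,
      ‖(α : ℂ) * ((x : ℂ) - 2 * Complex.I) ^ ((α : ℂ) - 1)‖ ≤ α * (y + 2) ^ m := by
    intro x hx
    -- A modulus at least `1` lets the exponent `α - 1`, possibly negative, be raised to `m`.
    have h1 : 1 ≤ ‖(x : ℂ) - 2 * Complex.I‖ := by
      have := Complex.abs_im_le_norm ((x : ℂ) - 2 * Complex.I)
      simp at this
      linarith
    have h2 : ‖(x : ℂ) - 2 * Complex.I‖ ≤ y + 2 := by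
      refine (norm_sub_le _ _).trans ?_
      simp [abs_of_nonneg hx.1, hx.2.le]
    rw [show (α : ℂ) - 1 = ((α - 1 : ℝ) : ℂ) by push_cast; ring, norm_mul,
      Complex.norm_cpow_real, Complex.norm_real, norm_of_nonneg hα.le]
    gcongr
    calc ‖(x : ℂ) - 2 * Complex.I‖ ^ (α - 1) ≤ ‖(x : ℂ) - 2 * Complex.I‖ ^ (m : ℝ) :=
          rpow_le_rpow_of_exponent_le h1 (by linarith)
      _ ≤ (y + 2) ^ (m : ℝ) := by gcongr
      _ = (y + 2) ^ m := rpow_natCast _ _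
  have h := norm_image_sub_le_of_norm_deriv_le_segment' hd hbound y ⟨hy, le_rfl⟩
  simp only [Complex.ofReal_zero, zero_sub, sub_zero] at h
  refine h.trans ?_
  have he := pow_div_factorial_le_exp (x := (y + 2) / 2) (by positivity) m
  rw [div_le_iff₀ (by positivity), div_pow, div_le_iff₀ (by positivity)] at he
  calc α * (y + 2) ^ m * y ≤ α * (exp ((y + 2) / 2) * m.factorial * 2 ^ m) * y := by gcongr
    _ = _ := by
      rw [show (y + 2) / 2 = 1 + y / 2 by ring, exp_add]
      ring

/-- The values of `e^{isz} (1 - z²)^α` along the ray `1 + iy`, up to the factor `e^{is}`. -/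
def rayIntegrand (α s y : ℝ) : ℂ :=
  ((y : ℂ) * (y - 2 * Complex.I)) ^ (α : ℂ) * (exp (-(s * y)) : ℝ)

/-- The base `y(y - 2i)` has real part `y² ≥ 0`, so it avoids the branch cut; at `y = 0`, `α > 0` is
what gives continuity. -/
lemma continuous_rayIntegrand {α : ℝ} (hα : 0 < α) (s : ℝ) : Continuous (rayIntegrand α s) := by
  refine Continuous.mul (continuous_iff_continuousAt.2 fun y => ?_) (by fun_prop)
  refine (Complex.continuousAt_cpow_const_of_re_pos (Or.inl ?_) (by simpa)).comp
    (f := fun y : ℝ => (y : ℂ) * (y - 2 * Complex.I)) (by fun_prop)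
  simp [mul_self_nonneg]

lemma integrableOn_rpow_mul_exp {α s : ℝ} (hα : 0 < α) (hs : 0 < s) :
    IntegrableOn (fun y : ℝ => y ^ α * exp (-(s * y))) (Set.Ioi 0) := by
  have := integrableOn_rpow_mul_exp_neg_mul_rpow (s := α) (p := 1) (b := s) (by linarith)
    one_pos hs
  simpa using this

/-- Watson's lemma to first order: freezing `(y - 2i)^α` at `y = 0` leaves a Gamma integral, and the
extra factor `y` in the error gains one power of `s`. -/
lemma exists_norm_integral_ray_sub_le {α : ℝ} (hα : 0 < α) :
    ∃ C, ∀ s : ℝ, 1 ≤ s → IntegrableOn (rayIntegrand α s) (Set.Ioi 0) ∧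
      ‖(∫ y in Set.Ioi (0 : ℝ), rayIntegrand α s y) -
        (-(2 * Complex.I)) ^ (α : ℂ) * (s ^ (-(α + 1)) * Gamma (α + 1) : ℝ)‖ ≤
          C * s ^ (-(α + 2)) := by
  obtain ⟨C, hC0, hC⟩ := exists_norm_cpow_sub_le hα
  refine ⟨C * (2 ^ (α + 2) * Gamma (α + 2)), fun s hs => ?_⟩
  have hs0 : 0 < s := by linarith
  have hle : ∀ y ∈ Set.Ioi (0 : ℝ),
      ‖rayIntegrand α s y - (-(2 * Complex.I)) ^ (α : ℂ) * (y ^ α * exp (-(s * y)) : ℝ)‖ ≤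
        C * (y ^ (α + 1) * exp (-(s / 2 * y))) := by
    intro y hy
    have hy0 : (0 : ℝ) < y := hy
    have e : rayIntegrand α s y - (-(2 * Complex.I)) ^ (α : ℂ) * (y ^ α * exp (-(s * y)) : ℝ) =
        (((y : ℂ) - 2 * Complex.I) ^ (α : ℂ) - (-(2 * Complex.I)) ^ (α : ℂ)) *
          (y ^ α * exp (-(s * y)) : ℝ) := by
      rw [rayIntegrand, ofReal_mul_cpow hy0.le (sub_two_I_ne_zero y) hα.ne']
      push_cast
      ring
    rw [e, norm_mul, Complex.norm_real, norm_of_nonneg (by positivity)]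
    calc _ ≤ C * (y * exp (y / 2)) * (y ^ α * exp (-(s * y))) := by
          gcongr
          exact hC y hy0.le
      _ = C * (y ^ (α + 1) * exp (y / 2 + -(s * y))) := by
          rw [rpow_add_one hy0.ne', exp_add]
          ring
      _ ≤ _ := by
          gcongr
          nlinarith
  have i1 : IntegrableOn (fun y : ℝ =>
      (-(2 * Complex.I)) ^ (α : ℂ) * ((y ^ α * exp (-(s * y)) : ℝ) : ℂ)) (Set.Ioi 0) :=
    (integrableOn_rpow_mul_exp hα hs0).ofReal.const_mul _
  have i2 : IntegrableOn (fun y : ℝ => C * (y ^ (α + 1) * exp (-(s / 2 * y)))) (Set.Ioi 0) :=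
    (integrableOn_rpow_mul_exp (by linarith) (by linarith)).const_mul _
  have i3 : IntegrableOn (fun y : ℝ => rayIntegrand α s y -
      (-(2 * Complex.I)) ^ (α : ℂ) * (y ^ α * exp (-(s * y)) : ℝ)) (Set.Ioi 0) :=
    i2.mono' ((continuous_rayIntegrand hα s).aestronglyMeasurable.sub i1.aestronglyMeasurable)
      ((ae_restrict_iff' measurableSet_Ioi).2 (.of_forall hle))
  have i4 : IntegrableOn (rayIntegrand α s) (Set.Ioi 0) := by
    refine (i3.add i1).congr (.of_forall fun y => ?_)
    simp only [Pi.add_apply, sub_add_cancel]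
  refine ⟨i4, ?_⟩
  have e1 : ∀ {a b : ℝ}, 0 < a → 0 < b → ∫ y in Set.Ioi (0 : ℝ), y ^ a * exp (-(b * y)) =
      b ^ (-(a + 1)) * Gamma (a + 1) := by
    intro a b ha hb
    have := integral_rpow_mul_exp_neg_mul_Ioi (a := a + 1) (by linarith) hb
    rw [add_sub_cancel_right] at this
    rw [this, one_div, inv_rpow hb.le, rpow_neg hb.le]
  rw [← e1 hα hs0, ← integral_complex_ofReal, ← integral_const_mul, ← integral_sub i4 i1]
  refine (norm_integral_le_of_norm_le i2
    ((ae_restrict_iff' measurableSet_Ioi).2 (.of_forall hle))).trans (le_of_eq ?_)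
  rw [integral_const_mul, e1 (by linarith) (by linarith), div_rpow hs0.le two_pos.le,
    rpow_neg two_pos.le, div_inv_eq_mul, show α + 1 + 1 = α + 2 by ring]
  ring

lemma norm_one_sub_sq_cpow_le {α : ℝ} (hα : 0 < α) {x y : ℝ} (hx : |x| ≤ 1) (hy : 0 ≤ y) :
    ‖(1 - ((x : ℂ) + y * Complex.I) ^ 2) ^ (α : ℂ)‖ ≤ (y + 2) ^ (2 * α) := by
  rw [Complex.norm_cpow_real, rpow_mul (by linarith), rpow_two]
  gcongr
  have h1 : ‖(x : ℂ) + y * Complex.I‖ ≤ 1 + y := by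
    refine (norm_add_le _ _).trans ?_
    simp [abs_of_nonneg hy, hx]
  calc ‖1 - ((x : ℂ) + y * Complex.I) ^ 2‖ ≤ 1 + ‖(x : ℂ) + y * Complex.I‖ ^ 2 := by
        refine (norm_sub_le _ _).trans ?_
        simp
    _ ≤ 1 + (1 + y) ^ 2 := by gcongr
    _ ≤ (y + 2) ^ 2 := by nlinarith

lemma norm_exp_I_mul (s x y : ℝ) :
    ‖Complex.exp (Complex.I * s * ((x : ℂ) + y * Complex.I))‖ = exp (-(s * y)) := by
  rw [Complex.norm_exp]
  simp

/-! ### Contour shift. -/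

/-- Poisson's integral as the imaginary part of a Laplace integral, by moving the contour. -/
lemma integral_cos_eq_im_integral_ray {α s : ℝ} (hα : 0 < α) (hs : 0 < s)
    (hint : IntegrableOn (rayIntegrand α s) (Set.Ioi 0)) :
    ∫ t in (-1 : ℝ)..1, cos (s * t) * (1 - t ^ 2) ^ α =
      2 * (Complex.exp (s * Complex.I) * ∫ y in Set.Ioi (0 : ℝ), rayIntegrand α s y).im := by
  set f : ℂ → ℂ := fun z => Complex.exp (Complex.I * s * z) * (1 - z ^ 2) ^ (α : ℂ) with hf
  -- Cauchy's theorem on `[-1, 1] × [0, R]`. There `Re (1 - z²) = 1 - x² + y² ≥ 0`, so the principal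
  -- power is continuous up to the corners `±1` and holomorphic inside.
  have hrect : ∀ R : ℝ, 0 < R →
      (∫ t in (-1 : ℝ)..1, cos (s * t) * (1 - t ^ 2) ^ α) =
        (∫ x in (-1 : ℝ)..1, f (x + R * Complex.I)).re +
          2 * (Complex.exp (s * Complex.I) * ∫ y in (0 : ℝ)..R, rayIntegrand α s y).im := by
    intro R hR
    have hre : ∀ z ∈ Set.Icc (-1 : ℝ) 1 ×ℂ Set.Icc 0 R, 0 ≤ (1 - z ^ 2).re := by
      rintro z ⟨⟨h1, h2⟩, -⟩
      simp only [Complex.sub_re, Complex.one_re, sq, Complex.mul_re]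
      nlinarith [mul_self_nonneg z.im]
    have hcauchy :=
      Complex.integral_boundary_rect_eq_zero_of_continuousOn_of_differentiableOn f (-1)
        (1 + R * Complex.I) (by
          simp only [Complex.neg_re, Complex.one_re, Complex.neg_im, Complex.one_im, neg_zero,
            Complex.add_re, Complex.add_im, Complex.re_ofReal_mul, Complex.im_ofReal_mul,
            Complex.I_re, Complex.I_im, mul_zero, mul_one, add_zero, zero_add]
          rw [Set.uIcc_of_le (by norm_num), Set.uIcc_of_le hR.le]
          intro z hz
          refine ContinuousAt.continuousWithinAt (ContinuousAt.mul (by fun_prop) ?_)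
          exact (Complex.continuousAt_cpow_const_of_re_pos (Or.inl (hre z hz))
            (by simpa)).comp (f := fun z : ℂ => 1 - z ^ 2) (by fun_prop))
        (by
          simp only [Complex.neg_re, Complex.one_re, Complex.neg_im, Complex.one_im, neg_zero,
            Complex.add_re, Complex.add_im, Complex.re_ofReal_mul, Complex.im_ofReal_mul,
            Complex.I_re, Complex.I_im, mul_zero, mul_one, add_zero, zero_add]
          rw [min_eq_left (by norm_num), max_eq_right (by norm_num), min_eq_left hR.le,
            max_eq_right hR.le]
          rintro z ⟨⟨h1, h2⟩, -⟩
          have hslit : 1 - z ^ 2 ∈ Complex.slitPlane := by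
            left
            simp only [Complex.sub_re, Complex.one_re, sq, Complex.mul_re]
            nlinarith [mul_self_nonneg z.im]
          refine DifferentiableAt.differentiableWithinAt (DifferentiableAt.mul (by fun_prop) ?_)
          exact DifferentiableAt.cpow_const (by fun_prop) hslit)
    simp only [Complex.neg_re, Complex.one_re, Complex.neg_im, Complex.one_im, neg_zero,
      Complex.add_re, Complex.add_im, Complex.re_ofReal_mul, Complex.im_ofReal_mul, Complex.I_re,
      Complex.I_im, mul_zero, mul_one, add_zero, zero_add, Complex.ofReal_zero, zero_mul,
      Complex.ofReal_neg, Complex.ofReal_one, smul_eq_mul] at hcauchy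
    have hright : ∀ y : ℝ, f (1 + y * Complex.I) =
        Complex.exp (s * Complex.I) * rayIntegrand α s y := by
      intro y
      simp only [hf, rayIntegrand]
      rw [show (1 : ℂ) - (1 + y * Complex.I) ^ 2 = y * (y - 2 * Complex.I) by
        linear_combination (-(y : ℂ) ^ 2) * Complex.I_sq, Complex.ofReal_exp,
        show Complex.I * s * (1 + y * Complex.I) = s * Complex.I + ((-(s * y) : ℝ) : ℂ) by
          push_cast
          linear_combination (s * y : ℂ) * Complex.I_sq, Complex.exp_add]
      ring
    -- Reflection `f(-z̄) = conj (f z)`: the vertical sides are conjugate, so together they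
    -- contribute twice an imaginary part.
    have hleft : ∀ y : ℝ, 0 ≤ y → f (-1 + y * Complex.I) =
        (starRingEnd ℂ) (f (1 + y * Complex.I)) := by
      intro y hy
      simp only [hf, map_mul, ← Complex.exp_conj]
      congr 1
      · simp [mul_assoc]
        ring_nf
      · rw [← Complex.conj_ofReal α, Complex.cpow_conj, Complex.conj_ofReal]
        · congr 2
          simp only [map_sub, map_neg, map_one, map_pow, map_add, map_mul, Complex.conj_ofReal,
            Complex.conj_I]
          ring
        · rw [Ne, Complex.arg_eq_pi_iff, not_and_or]
          left
          simp [sq, mul_self_nonneg]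
    have hbase : (∫ x in (-1 : ℝ)..1, f x).re =
        ∫ t in (-1 : ℝ)..1, cos (s * t) * (1 - t ^ 2) ^ α := by
      have e : ∫ x in (-1 : ℝ)..1, f x = ∫ x in (-1 : ℝ)..1,
          Complex.exp ((s * x : ℝ) * Complex.I) * (((1 - x ^ 2) ^ α : ℝ) : ℂ) := by
        refine intervalIntegral.integral_congr fun x hx => ?_
        rw [Set.uIcc_of_le (by norm_num)] at hx
        simp only [hf]
        rw [Complex.ofReal_cpow (by nlinarith [hx.1, hx.2])]
        push_cast
        ring_nf
      have hc : Continuous fun x : ℝ => (1 - x ^ 2) ^ α :=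
        (by fun_prop : Continuous fun t : ℝ => 1 - t ^ 2).rpow_const fun _ => Or.inr hα.le
      rw [e, ← Complex.reCLM_apply, ← Complex.reCLM.intervalIntegral_comp_comm
        ((by fun_prop : Continuous _).intervalIntegrable _ _)]
      refine intervalIntegral.integral_congr fun x _ => ?_
      simp only [Complex.reCLM_apply]
      rw [Complex.re_mul_ofReal, Complex.exp_ofReal_mul_I_re]
    rw [← hbase]
    have hL : ∫ y in (0 : ℝ)..R, f (-1 + y * Complex.I) =
        (starRingEnd ℂ) (∫ y in (0 : ℝ)..R, f (1 + y * Complex.I)) := by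
      rw [intervalIntegral.integral_of_le hR.le, intervalIntegral.integral_of_le hR.le,
        ← integral_conj, ← intervalIntegral.integral_of_le hR.le,
        ← intervalIntegral.integral_of_le hR.le]
      refine intervalIntegral.integral_congr fun y hy => ?_
      rw [Set.uIcc_of_le hR.le] at hy
      exact hleft y hy.1
    have hRt : ∫ y in (0 : ℝ)..R, f (1 + y * Complex.I) =
        Complex.exp (s * Complex.I) * ∫ y in (0 : ℝ)..R, rayIntegrand α s y := by
      rw [← intervalIntegral.integral_const_mul]
      exact intervalIntegral.integral_congr fun y _ => hright y
    rw [hL, hRt] at hcauchy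
    have := congrArg Complex.re hcauchy
    simp only [Complex.add_re, Complex.sub_re, Complex.I_mul_re, Complex.conj_im,
      Complex.zero_re] at this
    linarith
  have htop : Tendsto (fun R : ℝ => (∫ x in (-1 : ℝ)..1, f (x + R * Complex.I)).re) atTop
      (𝓝 0) := by
    -- The factor `exp (2 * s)` compensates for writing the decay `exp (-(s * R))` in the variable
    -- `R + 2`.
    have h1 : Tendsto (fun R : ℝ => exp (2 * s) * ((R + 2) ^ (2 * α) * exp (-s * (R + 2))) * 2)
        atTop (𝓝 0) := by
      simpa using (((tendsto_rpow_mul_exp_neg_mul_atTop_nhds_zero (2 * α) s hs).comp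
        (tendsto_atTop_add_const_right atTop 2 tendsto_id)).const_mul (exp (2 * s))).mul_const 2
    refine squeeze_zero_norm' ?_ h1
    filter_upwards [eventually_ge_atTop 0] with R hR
    refine (Complex.abs_re_le_norm _).trans ?_
    have := intervalIntegral.norm_integral_le_of_norm_le_const (a := (-1 : ℝ)) (b := 1)
      (f := fun x : ℝ => f (x + R * Complex.I))
      (C := exp (2 * s) * ((R + 2) ^ (2 * α) * exp (-s * (R + 2)))) (fun x hx => by
        rw [Set.uIoc_of_le (by norm_num)] at hx
        simp only [hf]
        rw [norm_mul, norm_exp_I_mul, mul_left_comm, ← exp_add, mul_comm]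
        refine mul_le_mul (norm_one_sub_sq_cpow_le hα (abs_le.2 ⟨hx.1.le, hx.2⟩) hR) ?_
          (exp_pos _).le (by positivity)
        rw [show 2 * s + -s * (R + 2) = -(s * R) by ring])
    refine this.trans (le_of_eq ?_)
    norm_num
  have hlim := htop.add (((Complex.continuous_im.tendsto _).comp
    ((intervalIntegral_tendsto_integral_Ioi 0 hint tendsto_id).const_mul
      (Complex.exp (s * Complex.I)))).const_mul 2)
  rw [zero_add] at hlim
  refine tendsto_nhds_unique (tendsto_const_nhds.congr' ?_) hlim
  filter_upwards [eventually_gt_atTop 0] with R hR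
  exact hrect R hR

/-! ### Asymptotics of the spherical mean. -/

/-- The leading term of `sphericalCos n s` as `s → ∞`. -/
def sphericalCosAsymptotic (n : ℕ) (s : ℝ) : ℝ :=
  Gamma ((n : ℝ) / 2) * 2 ^ (((n : ℝ) - 1) / 2) / √π * cos (s - ((n : ℝ) - 1) / 4 * π) *
    s ^ (-(((n : ℝ) - 1) / 2))

lemma two_mul_im_ray_main (α s c : ℝ) :
    2 * (Complex.exp (s * Complex.I) * ((-(2 * Complex.I)) ^ (α : ℂ) * (c : ℂ))).im =
      2 * 2 ^ α * c * sin (s - π * α / 2) := by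
  have e : Complex.exp (s * Complex.I) * ((-(2 * Complex.I)) ^ (α : ℂ) * (c : ℂ)) =
      ((2 ^ α * c : ℝ) : ℂ) * Complex.exp ((s - π * α / 2 : ℝ) * Complex.I) := by
    rw [neg_two_I_cpow, show ((s - π * α / 2 : ℝ) : ℂ) * Complex.I =
      s * Complex.I + -(π * α / 2 : ℝ) * Complex.I by push_cast; ring, Complex.exp_add]
    push_cast
    ring
  rw [e, Complex.im_ofReal_mul, Complex.exp_ofReal_mul_I_im]
  ring

lemma exists_sphericalCos_sub_le_of_three_lt {n : ℕ} (hn : 3 < n) :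
    ∃ C, ∀ s : ℝ, 1 ≤ s →
      |sphericalCos n s - sphericalCosAsymptotic n s| ≤ C * s ^ (-(((n : ℝ) + 1) / 2)) := by
  have hn3 : (3 : ℝ) < n := by exact_mod_cast hn
  obtain ⟨α, hαn⟩ : ∃ α, α = ((n : ℝ) - 3) / 2 := ⟨_, rfl⟩
  have hα : 0 < α := by linarith
  obtain ⟨C, hC⟩ := exists_norm_integral_ray_sub_le hα
  have g1 := Gamma_pos_of_pos (s := α + 1) (by linarith)
  have g2 := Gamma_pos_of_pos (s := (n : ℝ) / 2) (by linarith)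
  have hπ : 0 < √π := by positivity
  refine ⟨Gamma ((n : ℝ) / 2) / (√π * Gamma (α + 1)) * (2 * C), fun s hs => ?_⟩
  obtain ⟨hint, hle⟩ := hC s hs
  have h := integral_cos_mul_one_sub_sq_rpow hn s
  rw [← hαn, integral_cos_eq_im_integral_ray hα (by linarith) hint, integral_one_sub_sq_rpow hα,
    show α + 3 / 2 = (n : ℝ) / 2 by linarith] at h
  set P := ∫ y in Set.Ioi (0 : ℝ), rayIntegrand α s y
  have hΛ : sphericalCos n s = Gamma ((n : ℝ) / 2) / (√π * Gamma (α + 1)) *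
      (2 * (Complex.exp (s * Complex.I) * P).im) := by
    rw [h]
    field_simp
  have hA : sphericalCosAsymptotic n s = Gamma ((n : ℝ) / 2) / (√π * Gamma (α + 1)) *
      (2 * (Complex.exp (s * Complex.I) * ((-(2 * Complex.I)) ^ (α : ℂ) *
        (s ^ (-(α + 1)) * Gamma (α + 1) : ℝ))).im) := by
    rw [two_mul_im_ray_main, sphericalCosAsymptotic,
      -- Since `(n-1)/4 = α/2 + 1/2`, the sine from the ray becomes the stated cosine.
      show s - ((n : ℝ) - 1) / 4 * π = (s - π * α / 2) - π / 2 by rw [hαn]; ring,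
      cos_sub_pi_div_two, show ((n : ℝ) - 1) / 2 = α + 1 by linarith, rpow_add_one two_ne_zero]
    field_simp
  rw [hΛ, hA, ← mul_sub, ← mul_sub, ← Complex.sub_im, ← mul_sub, abs_mul, abs_mul,
    abs_of_pos (show 0 < Gamma ((n : ℝ) / 2) / (√π * Gamma (α + 1)) by positivity), abs_two,
    mul_assoc, mul_assoc, show ((n : ℝ) + 1) / 2 = α + 2 by linarith]
  gcongr
  refine (Complex.abs_im_le_norm _).trans ?_
  rw [norm_mul, Complex.norm_exp_ofReal_mul_I, one_mul]
  exact hle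

/-- In `sphericalCos_two` the term `s²/8 · Λ₆` carries the leading behaviour, while `Λ₄` is already
of the order `s^(-3/2)` of the error. -/
lemma exists_sphericalCos_two_sub_le :
    ∃ C, ∀ s : ℝ, 1 ≤ s →
      |sphericalCos 2 s - sphericalCosAsymptotic 2 s| ≤ C * s ^ (-((((2 : ℕ) : ℝ) + 1) / 2)) := by
  obtain ⟨C₄, h4⟩ := exists_sphericalCos_sub_le_of_three_lt (n := 4) (by norm_num)
  obtain ⟨C₆, h6⟩ := exists_sphericalCos_sub_le_of_three_lt (n := 6) (by norm_num)
  have hπ : 0 < √π := by positivity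
  have hC4 : 0 ≤ C₄ := by
    have := h4 1 le_rfl
    rw [one_rpow, mul_one] at this
    exact (abs_nonneg _).trans this
  set K := Gamma (((4 : ℕ) : ℝ) / 2) * 2 ^ ((((4 : ℕ) : ℝ) - 1) / 2) / √π with hK
  have hK0 : 0 ≤ K := by
    have := Gamma_pos_of_pos (s := ((4 : ℕ) : ℝ) / 2) (by norm_num)
    positivity
  refine ⟨C₄ + K + C₆ / 8, fun s hs => ?_⟩
  have hs0 : 0 < s := by linarith
  have hA : sphericalCosAsymptotic 2 s = -(s ^ 2 / 8 * sphericalCosAsymptotic 6 s) := by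
    have g1 : Gamma (((2 : ℕ) : ℝ) / 2) = 1 := by norm_num
    have g3 : Gamma (((6 : ℕ) : ℝ) / 2) = 2 := by
      rw [show ((6 : ℕ) : ℝ) / 2 = (2 : ℕ) + 1 by norm_num, Gamma_nat_eq_factorial]
      norm_num
    have p1 : (2 : ℝ) ^ ((((6 : ℕ) : ℝ) - 1) / 2) = 4 * 2 ^ ((((2 : ℕ) : ℝ) - 1) / 2) := by
      rw [show (((6 : ℕ) : ℝ) - 1) / 2 = (((2 : ℕ) : ℝ) - 1) / 2 + 2 by norm_num,
        rpow_add two_pos]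
      norm_num
      ring
    have p2 : s ^ (-((((2 : ℕ) : ℝ) - 1) / 2)) = s ^ 2 * s ^ (-((((6 : ℕ) : ℝ) - 1) / 2)) := by
      rw [← rpow_two, ← rpow_add hs0]
      norm_num
    -- The phases in dimensions 6 and 2 differ by `π`, which absorbs the minus sign of the
    -- recurrence.
    have p3 : cos (s - (((6 : ℕ) : ℝ) - 1) / 4 * π) = -cos (s - (((2 : ℕ) : ℝ) - 1) / 4 * π) := by
      rw [← cos_sub_pi]
      congr 1
      push_cast
      ring
    rw [sphericalCosAsymptotic, sphericalCosAsymptotic, g1, g3, p1, p2, p3]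
    ring
  have hA4 : |sphericalCosAsymptotic 4 s| ≤ K * s ^ (-((((2 : ℕ) : ℝ) + 1) / 2)) := by
    rw [sphericalCosAsymptotic, ← hK, abs_mul, abs_mul, abs_of_nonneg hK0,
      abs_of_nonneg (rpow_nonneg hs0.le _),
      show -((((4 : ℕ) : ℝ) - 1) / 2) = -((((2 : ℕ) : ℝ) + 1) / 2) by norm_num]
    gcongr
    exact mul_le_of_le_one_right hK0 (abs_cos_le_one _)
  have h4s : |sphericalCos 4 s - sphericalCosAsymptotic 4 s| ≤
      C₄ * s ^ (-((((2 : ℕ) : ℝ) + 1) / 2)) := by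
    refine (h4 s hs).trans ?_
    gcongr
    norm_num
  have h6s : s ^ 2 / 8 * |sphericalCos 6 s - sphericalCosAsymptotic 6 s| ≤
      C₆ / 8 * s ^ (-((((2 : ℕ) : ℝ) + 1) / 2)) := by
    have p : s ^ (-((((2 : ℕ) : ℝ) + 1) / 2)) = s ^ 2 * s ^ (-((((6 : ℕ) : ℝ) + 1) / 2)) := by
      rw [← rpow_two, ← rpow_add hs0]
      norm_num
    rw [p]
    calc _ ≤ s ^ 2 / 8 * (C₆ * s ^ (-((((6 : ℕ) : ℝ) + 1) / 2))) := by
          gcongr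
          exact h6 s hs
      _ = _ := by ring
  have e : sphericalCos 2 s - sphericalCosAsymptotic 2 s =
      (sphericalCos 4 s - sphericalCosAsymptotic 4 s) + sphericalCosAsymptotic 4 s -
        s ^ 2 / 8 * (sphericalCos 6 s - sphericalCosAsymptotic 6 s) := by
    rw [sphericalCos_two, hA]
    ring
  rw [e]
  refine (abs_sub _ _).trans ?_
  rw [abs_mul, abs_of_pos (by positivity : 0 < s ^ 2 / 8)]
  linarith [abs_add_le (sphericalCos 4 s - sphericalCosAsymptotic 4 s)
    (sphericalCosAsymptotic 4 s)]

lemma sphericalCos_eq_asymptotic {n : ℕ} (hn : n = 1 ∨ n = 3) {s : ℝ} (hs : 0 < s) :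
    sphericalCos n s = sphericalCosAsymptotic n s := by
  have hπ : 0 < √π := by positivity
  rcases hn with rfl | rfl
  · rw [sphericalCos_one, sphericalCosAsymptotic, Nat.cast_one, Gamma_one_half_eq]
    simp [hπ.ne']
  · have h := mul_sphericalCos_three s
    rw [sphericalCosAsymptotic, show ((3 : ℕ) : ℝ) / 2 = 1 / 2 + 1 by norm_num,
      Gamma_add_one (by norm_num), Gamma_one_half_eq,
      show (((3 : ℕ) : ℝ) - 1) / 2 = 1 by norm_num,
      show s - (((3 : ℕ) : ℝ) - 1) / 4 * π = s - π / 2 by push_cast; ring, cos_sub_pi_div_two,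
      rpow_one, rpow_neg_one, ← h]
    field_simp

/-- The high-frequency asymptotics of the cosine transform of the unit sphere. -/
lemma exists_sphericalCos_sub_le {n : ℕ} (hn : 1 ≤ n) :
    ∃ C, ∀ s : ℝ, 1 ≤ s →
      |sphericalCos n s - sphericalCosAsymptotic n s| ≤ C * s ^ (-(((n : ℝ) + 1) / 2)) := by
  by_cases h13 : n = 1 ∨ n = 3
  · refine ⟨0, fun s hs => ?_⟩
    rw [sphericalCos_eq_asymptotic h13 (by linarith)]
    simp
  · by_cases h2 : n = 2
    · subst h2
      exact exists_sphericalCos_two_sub_le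
    · exact exists_sphericalCos_sub_le_of_three_lt (by omega)

/-! ### High frequencies of the multiplier. -/

/-- The constants agree because `2n/δ² · Γ(n/2) = (2/δ)² Γ(n/2 + 1)`; the other powers of `δ` come
from rescaling `s = δ‖ν‖`. -/
lemma limitMultiplier_sub_highFrequencyPart (hn : 1 ≤ n) {δ : ℝ} (hδ : 0 < δ)
    (ν : EuclideanSpace ℝ (Fin n)) :
    limitMultiplier n δ ν - highFrequencyPart n δ ν =
      2 * n / δ ^ 2 * (sphericalCos n (δ * ‖ν‖) - sphericalCosAsymptotic n (δ * ‖ν‖)) := by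
  have hn0 : (0 : ℝ) < n := by exact_mod_cast hn
  have hp : (2 / δ) ^ (((n : ℝ) + 3) / 2) =
      2 ^ (((n : ℝ) - 1) / 2) * δ ^ (-(((n : ℝ) - 1) / 2)) * (2 / δ) ^ 2 := by
    rw [show ((n : ℝ) + 3) / 2 = ((n : ℝ) - 1) / 2 + 2 by ring, rpow_add (by positivity),
      rpow_two, div_rpow two_pos.le hδ.le, rpow_neg hδ.le, div_eq_mul_inv]
  rw [limitMultiplier_eq hn ν hδ, highFrequencyPart, sphericalCosAsymptotic, hp,
    Gamma_add_one (by positivity), ← sqrt_eq_rpow, mul_rpow hδ.le (norm_nonneg ν),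
    mul_comm ‖ν‖ δ]
  field_simp
  ring

lemma limitMultiplier_sub_highFrequencyPart_isBigO (hn : 1 ≤ n) {δ : ℝ} (hδ : 0 < δ) :
    (fun ν : EuclideanSpace ℝ (Fin n) => limitMultiplier n δ ν - highFrequencyPart n δ ν)
      =O[Bornology.cobounded (EuclideanSpace ℝ (Fin n))]
        (fun ν => ‖ν‖ ^ (-(((n : ℝ) + 1) / 2))) := by
  have hn0 : (0 : ℝ) < n := by exact_mod_cast hn
  obtain ⟨C, hC⟩ := exists_sphericalCos_sub_le hn
  refine IsBigO.of_bound (2 * n / δ ^ 2 * (C * δ ^ (-(((n : ℝ) + 1) / 2)))) ?_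
  filter_upwards [(tendsto_norm_cobounded_atTop (E := EuclideanSpace ℝ (Fin n))).eventually_ge_atTop
    (1 / δ)] with ν hν
  rw [div_le_iff₀' hδ] at hν
  rw [limitMultiplier_sub_highFrequencyPart hn hδ, norm_mul, norm_of_nonneg (by positivity),
    norm_of_nonneg (rpow_nonneg (norm_nonneg ν) _), mul_assoc, mul_assoc,
    ← mul_rpow hδ.le (norm_nonneg ν)]
  gcongr
  exact hC _ hν

lemma limitMultiplier_eq_highFrequencyPart (hn : n = 1 ∨ n = 3) {δ : ℝ} (hδ : 0 < δ)
    {ν : EuclideanSpace ℝ (Fin n)} (hν : 0 < ‖ν‖) :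
    limitMultiplier n δ ν - highFrequencyPart n δ ν = 0 := by
  rw [limitMultiplier_sub_highFrequencyPart (by omega) hδ,
    sphericalCos_eq_asymptotic hn (by positivity), sub_self, mul_zero]

end

end Peridynamic

theorem mainTheorem10 (n : ℕ) (hn : 1 ≤ n) (δ : ℝ) (hδ : 0 < δ) :
    (∀ ν : EuclideanSpace ℝ (Fin n),
      Tendsto (fun β : ℝ => Peridynamic.multiplier n δ β ν) atBot
        (𝓝 (Peridynamic.limitMultiplier n δ ν))) ∧
    (fun ν : EuclideanSpace ℝ (Fin n) =>
        Peridynamic.limitMultiplier n δ ν / (-‖ν‖ ^ 2)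
          - (1 - δ ^ 2 / (4 * ((n : ℝ) + 2)) * ‖ν‖ ^ 2))
      =O[𝓝[≠] 0] (fun ν => ‖ν‖ ^ 4) ∧
    (fun ν : EuclideanSpace ℝ (Fin n) =>
        Peridynamic.limitMultiplier n δ ν - Peridynamic.highFrequencyPart n δ ν)
      =O[Bornology.cobounded (EuclideanSpace ℝ (Fin n))]
        (fun ν => ‖ν‖ ^ (-(((n : ℝ) + 1) / 2))) ∧
    (n = 1 ∨ n = 3 →
      (fun ν : EuclideanSpace ℝ (Fin n) =>
          Peridynamic.limitMultiplier n δ ν - Peridynamic.highFrequencyPart n δ ν)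
        =O[Bornology.cobounded (EuclideanSpace ℝ (Fin n))]
          (fun ν => ‖ν‖ ^ (-(((n : ℝ) + 2) / 2)))) := by
  refine ⟨fun ν => ?_, Peridynamic.limitMultiplier_isBigO_zero hn hδ,
    Peridynamic.limitMultiplier_sub_highFrequencyPart_isBigO hn hδ, fun h13 => ?_⟩
  · rw [Peridynamic.limitMultiplier_eq hn ν hδ]
    exact Peridynamic.tendsto_multiplier hn ν hδ
  -- For `n = 1, 3` the error is zero away from the origin, so any rate would hold.
  · refine (isBigO_zero _ _).congr' ?_ EventuallyEq.rfl
    filter_upwards [(tendsto_norm_cobounded_atTop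
      (E := EuclideanSpace ℝ (Fin n))).eventually_gt_atTop 0] with ν hν
    exact (Peridynamic.limitMultiplier_eq_highFrequencyPart h13 hδ hν).symm
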